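/- Let $\alpha\ge 1$, $\beta>3^{\alpha/2}$, $\gamma\ge\tfrac14$ and $k\in\mathbb R$. For $F\in\mathrm{GL}^+(3)=\{F\in\mathbb R^{3\times3}:\det F>0\}$ let $$W(F)=\begin{cases}-\log\bigl(\beta-\|\operatorname{cof}F\|^{\alpha}\bigr)-\gamma\log\det F+\Bigl(\gamma-2\alpha\,\dfrac{3^{\alpha/2-1}}{\beta-3^{\alpha/2}}\Bigr)\det F+k,&\text{if }\|\operatorname{cof}F\|^{\alpha}<\beta,\\ \infty,&\text{otherwise,}\end{cases}$$ where $\|\cdot\|$ is the Frobenius norm, with inner product $\langle\cdot,\cdot\rangle$. On the space $\mathrm{Sym}(3)$ of symmetric matrices put $\widehat W(L)=W(\exp L)$; since $W$ is isotropic, $W(F)=\widehat W(\log V)$ for $V=\sqrt{FF^{T}}$. Let $\mathcal C=\{L\in\mathrm{Sym}(3):\widehat W(L)<\infty\}$ be the restricted domain and let $\widehat\sigma(L)=\frac{1}{\det\exp L}\,\mathrm D\widehat W(L)$ be the Cauchy stress as a function of the Hencky strain $L=\log V\in\mathcal C$ ($\mathrm D$ denoting the gradient on $\mathrm{Sym}(3)$).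 Then: 1. $W$ is polyconvex: there is a convex function $\mathcal P:\mathbb R^{3\times3}\times\mathbb R^{3\times3}\times(0,\infty)\to\mathbb R\cup\{\infty\}$ with $W(F)=\mathcal P(F,\operatorname{cof}F,\det F)$ for all $F\in\mathrm{GL}^+(3)$. 2. $W$ satisfies TSTS-M$^{++}$ on its restricted domain: $\mathcal C$ is open, $\widehat W$ and $\widehat\sigma$ are differentiable on $\mathcal C$, and $\langle \mathrm D\widehat\sigma(L).H,H\rangle>0$ for all $L\in\mathcal C$ and all $H\in\mathrm{Sym}(3)\setminus\{0\}$. 3. $W$ satisfies TSTS-M$^{+}$ on its restricted domain: $\langle\widehat\sigma(L')-\widehat\sigma(L),\,L'-L\rangle>0$ for all $L,L'\in\mathcal C$ with $L\ne L'$. -/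

import Mathlib

open scoped Matrix

/-- Real `3 × 3` matrices; they carry the Frobenius norm throughout. -/
abbrev Mat3 : Type := Matrix (Fin 3) (Fin 3) ℝ

attribute [local instance] Matrix.frobeniusNormedAddCommGroup Matrix.frobeniusNormedSpace

/-- The Frobenius inner product `⟪A, B⟫ = ∑ᵢⱼ Aᵢⱼ Bᵢⱼ`, which induces the Frobenius norm. -/
noncomputable instance Mat3.instInnerProductSpace : InnerProductSpace ℝ Mat3 where
  inner A B := ∑ i, ∑ j, A i j * B i j
  norm_sq_eq_re_inner A := by
    have h : (0 : ℝ) ≤ ∑ i, ∑ j, A i j ^ 2 :=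
      Finset.sum_nonneg fun i _ => Finset.sum_nonneg fun j _ => sq_nonneg _
    have h' : ‖A‖ = √(∑ i, ∑ j, A i j ^ 2) := by
      simp only [Matrix.frobenius_norm_def, Real.norm_eq_abs, Real.rpow_two, sq_abs,
        ← Real.sqrt_eq_rpow]
    rw [h', Real.sq_sqrt h]
    simp only [RCLike.re_to_real, pow_two]
  conj_inner_symm A B := by simp [mul_comm]
  add_left A B C := by simp [add_mul, Finset.sum_add_distrib]
  smul_left A B r := by simp [Finset.mul_sum, mul_assoc]

/-- The subspace of symmetric matrices. -/
def symSubmodule : Submodule ℝ Mat3 where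
  carrier := {A | A.IsSymm}
  add_mem' ha hb := Matrix.IsSymm.add ha hb
  zero_mem' := Matrix.isSymm_zero
  smul_mem' c _ ha := Matrix.IsSymm.smul ha c

/-- The space `Sym(3)` of symmetric matrices, with the Frobenius inner product. -/
def Sym3 : Type := symSubmodule

noncomputable instance Sym3.instNormedAddCommGroup : NormedAddCommGroup Sym3 :=
  inferInstanceAs (NormedAddCommGroup symSubmodule)

noncomputable instance Sym3.instInnerProductSpace : InnerProductSpace ℝ Sym3 :=
  inferInstanceAs (InnerProductSpace ℝ symSubmodule)

instance Sym3.instFiniteDimensional : FiniteDimensional ℝ Sym3 :=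
  inferInstanceAs (FiniteDimensional ℝ symSubmodule)

instance Sym3.instCompleteSpace : CompleteSpace Sym3 := FiniteDimensional.complete ℝ Sym3

/-- The inclusion of `Sym(3)` into the space of all matrices. -/
def Sym3.toMat : Sym3 →ₗ[ℝ] Mat3 := symSubmodule.subtype

/-- The cofactor matrix. -/
noncomputable def cof (F : Mat3) : Mat3 := (Matrix.adjugate F)ᵀ

/-- Polyconvexity of an energy `W : GL⁺(3) → ℝ ∪ {∞}` (only values at matrices of positive
determinant matter): there is a convex `P : ℝ³ˣ³ × ℝ³ˣ³ × ℝ⁺ → ℝ ∪ {∞}` with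
`W F = P (F, cof F, det F)` for all `F ∈ GL⁺(3)`. -/
def Polyconvex (W : Mat3 → EReal) : Prop :=
  ∃ P : Mat3 × Mat3 × ℝ → EReal,
    (∀ x, 0 < x.2.2 → P x ≠ ⊥) ∧
    (∀ x y : Mat3 × Mat3 × ℝ, 0 < x.2.2 → 0 < y.2.2 →
      ∀ a b : ℝ, 0 < a → 0 < b → a + b = 1 →
        P (a • x + b • y) ≤ (a : EReal) * P x + (b : EReal) * P y) ∧
    ∀ F : Mat3, 0 < F.det → W F = P (F, cof F, F.det)

/-- The restricted domain of an isotropic energy `W` in terms of the Hencky strain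
`L = log V ∈ Sym(3)`: those `L` at which the energy of the stretch `V = exp L` is finite. -/
def henckyDomain (W : Mat3 → EReal) : Set Sym3 :=
  {L | ∃ r : ℝ, W (NormedSpace.exp L.toMat) = (r : EReal)}

/-- The representation `Ŵ(log V)` of an isotropic energy as a function of the Hencky strain
(real-valued on `henckyDomain W`). -/
noncomputable def henckyEnergy (W : Mat3 → EReal) (L : Sym3) : ℝ :=
  (W (NormedSpace.exp L.toMat)).toReal

/-- The Cauchy stress response `σ̂(log V) = J⁻¹ D Ŵ(log V)`, where `J = det V` and `D` is
the gradient on `Sym(3)` for the Frobenius inner product. -/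
noncomputable def cauchyStress (W : Mat3 → EReal) (L : Sym3) : Sym3 :=
  (NormedSpace.exp L.toMat).det⁻¹ • gradient (henckyEnergy W) L

/-- The Cauchy stress response is well defined on the restricted domain: that domain is open and
`Ŵ` is differentiable at each of its points. -/
def HasStressResponse (W : Mat3 → EReal) : Prop :=
  IsOpen (henckyDomain W) ∧ ∀ L ∈ henckyDomain W, DifferentiableAt ℝ (henckyEnergy W) L

/-- TSTS-M⁺⁺ on the restricted domain: `σ̂` is differentiable and
`⟪D σ̂(log V).H, H⟫ > 0` for all admissible `log V` and all `H ∈ Sym(3) \ {0}`. -/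
def TSTSMPlusPlus (W : Mat3 → EReal) : Prop :=
  HasStressResponse W ∧
    ∀ L ∈ henckyDomain W, DifferentiableAt ℝ (cauchyStress W) L ∧
      ∀ H : Sym3, H ≠ 0 → 0 < inner ℝ (fderiv ℝ (cauchyStress W) L H) H

/-- TSTS-M⁺ on the restricted domain: `⟪σ̂(L') - σ̂(L), L' - L⟫ > 0` for all distinct
admissible Hencky strains `L, L'`. -/
def TSTSMPlus (W : Mat3 → EReal) : Prop :=
  HasStressResponse W ∧
    ∀ L ∈ henckyDomain W, ∀ L' ∈ henckyDomain W, L ≠ L' →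
      0 < inner ℝ (cauchyStress W L' - cauchyStress W L) (L' - L)

/-- The energy limited by the average deformation of area elements; `k` is the additive
constant. -/
noncomputable def areaLimitedEnergy (α β γ k : ℝ) (F : Mat3) : EReal :=
  open scoped Classical in
  if ‖cof F‖ ^ α < β then
    ((-Real.log (β - ‖cof F‖ ^ α) - γ * Real.log F.det
      + (γ - 2 * α * ((3 : ℝ) ^ (α / 2 - 1) / (β - (3 : ℝ) ^ (α / 2)))) * F.det + k : ℝ) : EReal)
  else ⊤

/-- The energy depends on `F ∈ GL⁺(3)` only through its Hencky strain: if `exp L = V` is the left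
stretch of `F`, i.e. `V² = F Fᵀ`, then `W(F) = W(exp L)`. -/
theorem areaLimitedEnergy_eq_exp (α β γ k : ℝ) (F : Mat3) (hF : 0 < F.det) (L : Sym3)
    (hL : NormedSpace.exp L.toMat * NormedSpace.exp L.toMat = F * Fᵀ) :
    areaLimitedEnergy α β γ k F = areaLimitedEnergy α β γ k (NormedSpace.exp L.toMat) := by
  have hs : (NormedSpace.exp L.toMat)ᵀ = NormedSpace.exp L.toMat :=
    Matrix.IsSymm.exp (A := L.toMat) L.2
  have hpos : 0 < (NormedSpace.exp L.toMat).det := by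
    have hu := (Matrix.isUnit_iff_isUnit_det _).1 (Matrix.isUnit_exp L.toMat)
    have h2 := Matrix.exp_nsmul 2 ((1 / 2 : ℝ) • L.toMat)
    rw [← Nat.cast_smul_eq_nsmul ℝ, smul_smul] at h2
    norm_num at h2
    refine lt_of_le_of_ne ?_ hu.ne_zero.symm
    rw [h2, Matrix.det_pow]
    positivity
  generalize NormedSpace.exp L.toMat = V at hL hs hpos ⊢
  have hdet : F.det = V.det := by
    have h := congrArg Matrix.det hL
    rw [Matrix.det_mul, Matrix.det_mul, Matrix.det_transpose] at h
    nlinarith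
  have key : ∀ A : Mat3, ‖cof A‖ ^ 2 = (Matrix.adjugate (A * Aᵀ)).trace := by
    intro A
    have h1 : ‖cof A‖ ^ 2 = inner ℝ (cof A) (cof A) := (real_inner_self_eq_norm_sq _).symm
    have h2 : inner ℝ (cof A) (cof A) = (cof A * (cof A)ᵀ).trace := by
      simp [Matrix.trace, Matrix.mul_apply, inner]
    rw [h1, h2, Matrix.adjugate_mul_distrib, cof, Matrix.transpose_transpose,
      Matrix.adjugate_transpose]
  have hcof : ‖cof F‖ = ‖cof V‖ := by
    have h := (key F).trans ((congrArg (fun B : Mat3 => (Matrix.adjugate B).trace)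
      (hL.symm.trans (by rw [hs]))).trans (key V).symm)
    exact (sq_eq_sq₀ (norm_nonneg _) (norm_nonneg _)).1 h
  simp only [areaLimitedEnergy, hdet, hcof]

/-!
Write `L` for the Hencky strain, `V = exp L`, `j = tr L` and `p = α / 2`. Since
`cof V = exp ((tr L) 1 - L)`, the area term `‖cof V‖²` equals `s(L) = tr (exp (K L))` with the
linear map `K L = 2 ((tr L) 1 - L)`, and the energy becomes
`-log (β - s ^ p) - γ j + c eʲ + k`, finite exactly where `s ^ p < β`. With
`ψ(s) = p s ^ (p - 1) / (β - s ^ p)` the Cauchy stress is `e⁻ʲ (ψ(s) ∇s - γ 1) + c 1`, so the value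
of `c` plays no role for monotonicity.

Along a line in direction `H`, put `h = tr H`, and let `a` and `b` be the first and second derivatives
of `s`. The stress tested against `H` has derivative
`e⁻ʲ (ψ' a² + ψ b - ψ h a + γ h²)`. The trace exponential is log-convex, i.e. `a² ≤ s b`, and
`ψ' + ψ / s = β ψ² / s ^ p`, so the bracket dominates a quadratic form in `(a, h)` whose
discriminant is negative because `s ^ p < β ≤ 4 γ β`; together with `b > 0` this is positivity
(`stress_quadratic_pos`). The restricted domain is convex because `s` is, so positivity
integrates along segments to strict monotonicity.

The matrix-analytic input is Duhamel's formula
`D exp X N = ∫₀¹ exp (t X) N exp ((1 - t) X) dt`, used only through bounds on its integrand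
(`le_fderiv_exp`). For symmetric `X` and `N` the integrand paired with `N` is
`‖exp (t X / 2) N exp ((1 - t) X / 2)‖²`, and the Cauchy–Schwarz inequality against `exp (X / 2)`
yields the log-convexity (`Mat3.sq_trace_exp_mul_le`).

Polyconvexity is independent of this: `-log (β - ‖A‖ ^ α)` is convex in `A` and `-log` is
convex on the positive reals.
-/

/-! ### Duhamel bounds for the derivative of the exponential in a Banach algebra -/

section BanachAlgebra

open NormedSpace Filter Topology

variable {𝔸 : Type*} [NormedRing 𝔸] [NormedAlgebra ℝ 𝔸] [CompleteSpace 𝔸]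

theorem differentiable_normedSpace_exp : Differentiable ℝ (exp : 𝔸 → 𝔸) :=
  fun x => (exp_analytic (𝕂 := ℝ) x).differentiableAt

/-- The mean value theorem for `t ↦ ℓ (exp (t Y) * exp ((1 - t) X))`, a path from `ℓ (exp X)` to
`ℓ (exp Y)`: a mean value form of Duhamel's formula. -/
theorem exists_exp_sub_exp_eq (ℓ : 𝔸 →L[ℝ] ℝ) (X Y : 𝔸) :
    ∃ t ∈ Set.Icc (0 : ℝ) 1,
      ℓ (exp Y) - ℓ (exp X) = ℓ (exp (t • Y) * (Y - X) * exp ((1 - t) • X)) := by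
  have hd : ∀ t : ℝ, HasDerivAt (fun t : ℝ => ℓ (exp (t • Y) * exp ((1 - t) • X)))
      (ℓ (exp (t • Y) * (Y - X) * exp ((1 - t) • X))) t := by
    intro t
    have h1 : HasDerivAt (fun t : ℝ => exp (t • Y)) (exp (t • Y) * Y) t :=
      hasDerivAt_exp_smul_const Y t
    have h2 : HasDerivAt (fun t : ℝ => exp ((1 - t) • X)) (-(X * exp ((1 - t) • X))) t := by
      have h := (hasDerivAt_exp_smul_const' (𝕂 := ℝ) X (1 - t)).scomp t
        ((hasDerivAt_id' t).const_sub 1)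
      rwa [neg_one_smul] at h
    have h3 : exp (t • Y) * (Y - X) * exp ((1 - t) • X) =
        exp (t • Y) * Y * exp ((1 - t) • X) + exp (t • Y) * -(X * exp ((1 - t) • X)) := by
      noncomm_ring
    rw [h3]
    exact ℓ.hasFDerivAt.comp_hasDerivAt t (h1.mul h2)
  obtain ⟨t, ht, h⟩ := exists_hasDerivAt_eq_slope _ _ (zero_lt_one (α := ℝ))
    (fun t _ => (hd t).continuousAt.continuousWithinAt) (fun t _ => hd t)
  refine ⟨t, Set.Ioo_subset_Icc_self ht, ?_⟩
  rw [h]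
  simp

/-- A consequence of Duhamel's formula `D exp X N = ∫₀¹ exp (t X) N exp ((1 - t) X) dt` that
does not need the integral: a lower bound for `ℓ` on all values of the integrand is a lower bound
for `ℓ` on the derivative. -/
theorem le_fderiv_exp (ℓ : 𝔸 →L[ℝ] ℝ) (X N : 𝔸) (q : ℝ)
    (hq : ∀ t ∈ Set.Icc (0 : ℝ) 1, q ≤ ℓ (exp (t • X) * N * exp ((1 - t) • X))) :
    q ≤ ℓ (fderiv ℝ exp X N) := by
  -- By compactness of `[0, 1]`, any bound below `q` survives replacing `X` by
  -- `X + ε N` in one factor.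
  refine le_of_forall_lt fun r hr => ?_
  obtain ⟨r', hr', hr''⟩ := exists_between hr
  refine lt_of_lt_of_le hr' ?_
  have hcont : Continuous fun z : ℝ × ℝ =>
      ℓ (exp (z.2 • (X + z.1 • N)) * N * exp ((1 - z.2) • X)) := by
    have := (differentiable_normedSpace_exp (𝔸 := 𝔸)).continuous
    fun_prop
  have hunif : ∀ᶠ ε in 𝓝 (0 : ℝ), ∀ t ∈ Set.Icc (0 : ℝ) 1,
      r' < ℓ (exp (t • (X + ε • N)) * N * exp ((1 - t) • X)) := by
    refine isCompact_Icc.eventually_forall_of_forall_eventually fun t ht => ?_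
    refine hcont.continuousAt.eventually (lt_mem_nhds ?_)
    simpa using hr''.trans_le (hq t ht)
  have hline : HasDerivAt (fun ε : ℝ => ℓ (exp (X + ε • N))) (ℓ (fderiv ℝ exp X N)) 0 := by
    have h1 : HasDerivAt (fun ε : ℝ => X + ε • N) N 0 := by
      simpa using ((hasDerivAt_id (0 : ℝ)).smul_const N).const_add X
    have h2 : HasFDerivAt (exp : 𝔸 → 𝔸) (fderiv ℝ exp X) (X + (0 : ℝ) • N) := by
      simpa using (differentiable_normedSpace_exp X).hasFDerivAt
    exact ℓ.hasFDerivAt.comp_hasDerivAt 0 (h2.comp_hasDerivAt 0 h1)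
  have hslope := (hasDerivAt_iff_tendsto_slope_zero.1 hline).mono_left
    (nhdsWithin_mono 0 (fun x (hx : x ∈ Set.Ioi (0 : ℝ)) => ne_of_gt hx))
  refine ge_of_tendsto hslope ?_
  filter_upwards [hunif.filter_mono nhdsWithin_le_nhds, self_mem_nhdsWithin] with ε hε hpos
  obtain ⟨t, ht, h⟩ := exists_exp_sub_exp_eq ℓ X (X + ε • N)
  have hpos' : (0 : ℝ) < ε := hpos
  have h' : ℓ (exp (X + ε • N)) - ℓ (exp X) =
      ε * ℓ (exp (t • (X + ε • N)) * N * exp ((1 - t) • X)) := by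
    rw [h]; simp
  simp only [zero_add, zero_smul, add_zero, smul_eq_mul]
  rw [h', inv_mul_cancel_left₀ hpos'.ne']
  exact (hε t ht).le

end BanachAlgebra

/-! ### The trace of the exponential of symmetric matrices -/

section MatrixExponential

open NormedSpace

/-- Transfer from Banach algebras: the Frobenius norm is submultiplicative. -/
theorem Mat3.differentiable_exp : Differentiable ℝ (exp : Mat3 → Mat3) :=
  letI := Matrix.frobeniusNormedRing (m := Fin 3) (α := ℝ)
  letI := Matrix.frobeniusNormedAlgebra (m := Fin 3) (R := ℝ) (α := ℝ)
  differentiable_normedSpace_exp (𝔸 := Mat3)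

theorem Mat3.le_fderiv_exp (ℓ : Mat3 →L[ℝ] ℝ) (X N : Mat3) (q : ℝ)
    (hq : ∀ t ∈ Set.Icc (0 : ℝ) 1, q ≤ ℓ (exp (t • X) * N * exp ((1 - t) • X))) :
    q ≤ ℓ (fderiv ℝ exp X N) :=
  letI := Matrix.frobeniusNormedRing (m := Fin 3) (α := ℝ)
  letI := Matrix.frobeniusNormedAlgebra (m := Fin 3) (R := ℝ) (α := ℝ)
  _root_.le_fderiv_exp (𝔸 := Mat3) ℓ X N q hq

theorem Mat3.inner_eq_trace (A B : Mat3) : inner ℝ A B = (A * Bᵀ).trace := by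
  simp [Matrix.trace, Matrix.mul_apply, inner]

theorem Mat3.norm_sq_eq_trace (A : Mat3) : ‖A‖ ^ 2 = (A * Aᵀ).trace := by
  rw [← Mat3.inner_eq_trace, real_inner_self_eq_norm_sq]

theorem Mat3.exp_smul_mul_exp_smul (a b : ℝ) (X : Mat3) :
    exp (a • X) * exp (b • X) = exp ((a + b) • X) := by
  rw [add_smul, Matrix.exp_add_of_commute]
  exact ((Commute.refl X).smul_left a).smul_right b

theorem Mat3.exp_one_sub_smul_mul_exp_smul (t : ℝ) (X : Mat3) :
    exp ((1 - t) • X) * exp (t • X) = exp X := by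
  rw [Mat3.exp_smul_mul_exp_smul, sub_add_cancel, one_smul]

theorem Mat3.isSymm_exp_smul {X : Mat3} (hX : X.IsSymm) (t : ℝ) : (exp (t • X) : Mat3).IsSymm :=
  (hX.smul t).exp

/-- The functional `A ↦ tr (A Z)`. -/
noncomputable def traceMulCLM (Z : Mat3) : Mat3 →L[ℝ] ℝ :=
  LinearMap.toContinuousLinearMap
    { toFun := fun A => (A * Z).trace
      map_add' := fun A B => by rw [add_mul, Matrix.trace_add]
      map_smul' := fun c A => by simp }

@[simp] theorem traceMulCLM_apply (Z A : Mat3) : traceMulCLM Z A = (A * Z).trace := rfl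

/-- With `Z = 1` the integrand in Duhamel's formula has constant trace. -/
theorem Mat3.trace_fderiv_exp (X N : Mat3) :
    (fderiv ℝ exp X N).trace = (exp X * N).trace := by
  have key : ∀ t : ℝ, (exp (t • X) * N * exp ((1 - t) • X)).trace = (exp X * N).trace := by
    intro t
    rw [Matrix.trace_mul_comm, ← mul_assoc, Mat3.exp_one_sub_smul_mul_exp_smul]
  have h1 := Mat3.le_fderiv_exp (traceMulCLM 1) X N (exp X * N).trace
    fun t _ => by simp [key]
  -- The constant is also an upper bound: apply the lower bound to the negated functional.
  have h2 := Mat3.le_fderiv_exp (-traceMulCLM 1) X N (-(exp X * N).trace)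
    fun t _ => by simp [key]
  simp only [neg_apply, traceMulCLM_apply, mul_one] at h1 h2
  linarith

/-- For symmetric `X`, `N` the integrand in Duhamel's formula, paired with `N`, is a squared
norm. -/
theorem Mat3.trace_exp_mul_exp_mul {X N : Mat3} (hX : X.IsSymm) (hN : N.IsSymm) (t : ℝ) :
    (exp (t • X) * N * exp ((1 - t) • X) * N).trace =
      ‖(exp ((t / 2) • X) * N * exp (((1 - t) / 2) • X) : Mat3)‖ ^ 2 := by
  have h1 := Mat3.exp_smul_mul_exp_smul (t / 2) (t / 2) X
  have h2 := Mat3.exp_smul_mul_exp_smul ((1 - t) / 2) ((1 - t) / 2) X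
  rw [add_halves] at h1 h2
  rw [Mat3.norm_sq_eq_trace, Matrix.transpose_mul, Matrix.transpose_mul,
    (Mat3.isSymm_exp_smul hX _).eq, (Mat3.isSymm_exp_smul hX _).eq, hN.eq, ← h1, ← h2]
  generalize (exp ((t / 2) • X) : Mat3) = P
  generalize (exp (((1 - t) / 2) • X) : Mat3) = Q
  rw [show P * P * N * (Q * Q) * N = P * (P * N * (Q * Q) * N) by noncomm_ring,
    Matrix.trace_mul_comm]
  congr 1
  noncomm_ring

theorem Mat3.trace_exp {X : Mat3} (hX : X.IsSymm) :
    (exp X : Mat3).trace = ‖(exp ((1 / 2 : ℝ) • X) : Mat3)‖ ^ 2 := by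
  rw [Mat3.norm_sq_eq_trace, (Mat3.isSymm_exp_smul hX _).eq, Mat3.exp_smul_mul_exp_smul]
  norm_num

theorem Mat3.trace_exp_pos {X : Mat3} (hX : X.IsSymm) : 0 < (exp X : Mat3).trace := by
  rw [Mat3.trace_exp hX]
  have : (exp ((1 / 2 : ℝ) • X) : Mat3) ≠ 0 := (Matrix.isUnit_exp _).ne_zero
  positivity

/-- Infinitesimal form of the convexity of `X ↦ log (tr (exp X))`. By Cauchy–Schwarz against
`exp (X / 2)` the bound holds for every value of the integrand in Duhamel's formula. -/
theorem Mat3.sq_trace_exp_mul_le {X N : Mat3} (hX : X.IsSymm) (hN : N.IsSymm) :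
    (exp X * N).trace ^ 2 ≤ (exp X).trace * (fderiv ℝ exp X N * N).trace := by
  have hs := Mat3.trace_exp_pos hX
  rw [← div_le_iff₀' hs]
  refine Mat3.le_fderiv_exp (traceMulCLM N) X N _ fun t _ => ?_
  rw [traceMulCLM_apply, div_le_iff₀' hs, Mat3.trace_exp_mul_exp_mul hX hN, Mat3.trace_exp hX,
    ← mul_pow, sq_le_sq, abs_of_nonneg (mul_nonneg (norm_nonneg _) (norm_nonneg _)), mul_comm]
  refine le_trans (le_of_eq ?_) (abs_real_inner_le_norm _ _)
  rw [Mat3.inner_eq_trace, (Mat3.isSymm_exp_smul hX _).eq, mul_assoc, mul_assoc,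
    Matrix.trace_mul_comm (exp ((t / 2) • X)), mul_assoc N, Mat3.exp_smul_mul_exp_smul,
    Mat3.exp_smul_mul_exp_smul, show (1 - t) / 2 + 1 / 2 + t / 2 = 1 by ring, one_smul,
    Matrix.trace_mul_comm N]

/-- The integrand in Duhamel's formula is positive and continuous, hence bounded away from zero. -/
theorem Mat3.trace_fderiv_exp_mul_pos {X N : Mat3} (hX : X.IsSymm) (hN : N.IsSymm) (h0 : N ≠ 0) :
    0 < (fderiv ℝ exp X N * N).trace := by
  have hcont : Continuous fun t : ℝ => (exp (t • X) * N * exp ((1 - t) • X) * N).trace := by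
    have := Mat3.differentiable_exp.continuous
    fun_prop
  obtain ⟨t₀, -, ht₀⟩ := (isCompact_Icc (a := (0 : ℝ)) (b := 1)).exists_isMinOn
    ⟨0, by simp⟩ hcont.continuousOn
  refine lt_of_lt_of_le ?_ (Mat3.le_fderiv_exp (traceMulCLM N) X N _ fun t ht => ht₀ ht)
  simp only [Mat3.trace_exp_mul_exp_mul hX hN]
  have hne : (exp ((t₀ / 2) • X) * N * exp (((1 - t₀) / 2) • X) : Mat3) ≠ 0 := by
    rw [Ne, (Matrix.isUnit_exp _).mul_left_eq_zero, (Matrix.isUnit_exp _).mul_right_eq_zero]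
    exact h0
  positivity

theorem Mat3.det_exp {X : Mat3} (hX : X.IsSymm) : (exp X).det = Real.exp X.trace := by
  have hH : X.IsHermitian := by
    rwa [Matrix.IsHermitian, Matrix.conjTranspose_eq_transpose_of_trivial]
  have h : X = (Unitary.toUnits hH.eigenvectorUnitary : Mat3) * Matrix.diagonal hH.eigenvalues *
      ((Unitary.toUnits hH.eigenvectorUnitary)⁻¹ : Mat3ˣ) := hH.spectral_theorem
  have ht : X.trace = ∑ i, hH.eigenvalues i := hH.trace_eq_sum_eigenvalues
  rw [ht]
  conv_lhs => rw [h]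
  rw [Matrix.exp_units_conj, Matrix.det_units_conj, Matrix.exp_diagonal, Matrix.det_diagonal,
    Real.exp_sum]
  simp [Real.exp_eq_exp_ℝ]

end MatrixExponential

/-! ### The area stretch as a function of the Hencky strain -/

section HenckyStrain

open NormedSpace

theorem Sym3.toMat_injective : Function.Injective Sym3.toMat := Subtype.val_injective

theorem Sym3.isSymm_toMat (L : Sym3) : L.toMat.IsSymm := L.2

/-- The trace, as a continuous linear functional on `Sym(3)`. -/
noncomputable def traceSym : Sym3 →L[ℝ] ℝ :=
  LinearMap.toContinuousLinearMap ((Matrix.traceLinearMap (Fin 3) ℝ ℝ).comp Sym3.toMat)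

@[simp] theorem traceSym_apply (L : Sym3) : traceSym L = L.toMat.trace := rfl

/-- The linear map `L ↦ 2 ((tr L) 1 - L)`. For `V = exp L` its value is the logarithm of
`(cof V)²`. -/
noncomputable def cofStrain : Sym3 →L[ℝ] Mat3 :=
  LinearMap.toContinuousLinearMap
    ((2 : ℝ) • (((Matrix.traceLinearMap (Fin 3) ℝ ℝ).comp Sym3.toMat).smulRight (1 : Mat3)
      - Sym3.toMat))

theorem cofStrain_apply (L : Sym3) :
    cofStrain L = (2 : ℝ) • (L.toMat.trace • (1 : Mat3) - L.toMat) := rfl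

theorem isSymm_cofStrain (L : Sym3) : (cofStrain L).IsSymm := by
  rw [cofStrain_apply]
  exact ((Matrix.isSymm_one.smul _).sub L.isSymm_toMat).smul _

theorem cofStrain_injective : Function.Injective cofStrain := by
  rw [injective_iff_map_eq_zero]
  intro L h
  rw [cofStrain_apply, smul_eq_zero_iff_right two_ne_zero] at h
  have ht := congrArg Matrix.trace h
  simp only [Matrix.trace_sub, Matrix.trace_smul, Matrix.trace_one, Fintype.card_fin,
    smul_eq_mul, Matrix.trace_zero] at ht
  push_cast at ht
  have ht' : L.toMat.trace = 0 := by linarith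
  rw [ht', zero_smul, zero_sub, neg_eq_zero] at h
  exact Sym3.toMat_injective (by rw [h, map_zero])

/-- The squared area stretch `‖cof V‖²` of `V = exp L`, as a function of `L`. -/
noncomputable def areaSq (L : Sym3) : ℝ := (exp (cofStrain L)).trace

theorem areaSq_pos (L : Sym3) : 0 < areaSq L := Mat3.trace_exp_pos (isSymm_cofStrain L)

theorem Mat3.exp_smul_one (c : ℝ) : exp (c • (1 : Mat3)) = Real.exp c • (1 : Mat3) := by
  rw [← Matrix.diagonal_one, ← Matrix.diagonal_smul, Matrix.exp_diagonal, ← Matrix.diagonal_smul]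
  congr 1
  ext i
  simp [Real.exp_eq_exp_ℝ]

theorem norm_cof_exp_sq (L : Sym3) : ‖cof (exp L.toMat)‖ ^ 2 = areaSq L := by
  have hu : IsUnit (exp L.toMat).det :=
    (Matrix.isUnit_iff_isUnit_det _).1 (Matrix.isUnit_exp L.toMat)
  have hadj : Matrix.adjugate (exp L.toMat) = Real.exp L.toMat.trace • exp (-L.toMat) := by
    rw [← Mat3.det_exp L.isSymm_toMat, Matrix.exp_neg, Matrix.inv_def, smul_smul,
      Ring.mul_inverse_cancel _ hu, one_smul]
  have hsplit : cofStrain L = (2 * L.toMat.trace) • (1 : Mat3) + (2 : ℝ) • -L.toMat := by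
    rw [cofStrain_apply, smul_sub, smul_smul, smul_neg, sub_eq_add_neg]
  have hexp := Mat3.exp_smul_mul_exp_smul 1 1 (-L.toMat)
  rw [one_smul, one_add_one_eq_two] at hexp
  rw [Mat3.norm_sq_eq_trace, cof, Matrix.transpose_transpose, hadj, Matrix.transpose_smul,
    (L.isSymm_toMat.neg.exp).eq, areaSq, hsplit, Matrix.exp_add_of_commute _ _
      ((Commute.one_left _).smul_left _), Mat3.exp_smul_one, smul_mul_smul_comm, hexp,
      smul_mul_assoc, one_mul, ← Real.exp_add, two_mul]

theorem norm_cof_exp_rpow (α : ℝ) (L : Sym3) :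
    ‖cof (exp L.toMat)‖ ^ α = areaSq L ^ (α / 2) := by
  rw [← norm_cof_exp_sq, ← Real.rpow_natCast_mul (norm_nonneg _)]
  congr 1
  push_cast
  ring

/-- The adjoint of `cofStrain`, applied to `exp (cofStrain L)`: the gradient of `areaSq`. -/
noncomputable def areaSqGrad (L : Sym3) : Sym3 :=
  ContinuousLinearMap.adjoint cofStrain (exp (cofStrain L))

theorem inner_areaSqGrad (L H : Sym3) :
    inner ℝ (areaSqGrad L) H = (exp (cofStrain L) * cofStrain H).trace := by
  have h : inner ℝ (exp (cofStrain L)) (cofStrain H) = (exp (cofStrain L) * cofStrain H).trace := by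
    rw [Mat3.inner_eq_trace, (isSymm_cofStrain H).eq]
  exact (ContinuousLinearMap.adjoint_inner_left cofStrain H (exp (cofStrain L))).trans h

/-- The identity matrix, as an element of `Sym(3)`: the gradient of the trace. -/
def oneSym : Sym3 := ⟨(1 : Mat3), Matrix.isSymm_one⟩

theorem inner_oneSym (H : Sym3) : inner ℝ oneSym H = traceSym H := by
  change inner ℝ (1 : Mat3) H.toMat = H.toMat.trace
  rw [Mat3.inner_eq_trace, H.isSymm_toMat.eq, one_mul]

theorem differentiable_areaSqGrad : Differentiable ℝ areaSqGrad :=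
  (ContinuousLinearMap.adjoint cofStrain).differentiable.comp
    (Mat3.differentiable_exp.comp cofStrain.differentiable)

theorem hasGradientAt_areaSq (L : Sym3) : HasGradientAt areaSq (areaSqGrad L) L := by
  rw [hasGradientAt_iff_hasFDerivAt]
  have h := (traceMulCLM 1).hasFDerivAt.comp L
    ((Mat3.differentiable_exp (cofStrain L)).hasFDerivAt.comp L cofStrain.hasFDerivAt)
  refine (h.congr_fderiv ?_).congr_of_eventuallyEq (.of_forall fun L => ?_)
  · ext H
    rw [InnerProductSpace.toDual_apply_apply, inner_areaSqGrad, ← Mat3.trace_fderiv_exp]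
    exact congrArg Matrix.trace (mul_one (fderiv ℝ exp (cofStrain L) (cofStrain H)))
  · simp [areaSq]

/-- The second derivative of `areaSq` at `L` in the direction `H`. -/
noncomputable def areaSqHess (L H : Sym3) : ℝ :=
  (fderiv ℝ exp (cofStrain L) (cofStrain H) * cofStrain H).trace

theorem sq_inner_areaSqGrad_le (L H : Sym3) :
    inner ℝ (areaSqGrad L) H ^ 2 ≤ areaSq L * areaSqHess L H := by
  rw [inner_areaSqGrad]
  exact Mat3.sq_trace_exp_mul_le (isSymm_cofStrain L) (isSymm_cofStrain H)

theorem areaSqHess_pos (L : Sym3) {H : Sym3} (hH : H ≠ 0) : 0 < areaSqHess L H :=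
  Mat3.trace_fderiv_exp_mul_pos (isSymm_cofStrain L) (isSymm_cofStrain H)
    ((map_ne_zero_iff _ cofStrain_injective).2 hH)

theorem Sym3.hasDerivAt_line (L H : Sym3) (τ : ℝ) : HasDerivAt (fun τ : ℝ => L + τ • H) H τ := by
  simpa using ((hasDerivAt_id' τ).smul_const H).const_add L

theorem hasDerivAt_areaSq_line (L H : Sym3) (τ : ℝ) :
    HasDerivAt (fun τ : ℝ => areaSq (L + τ • H)) (inner ℝ (areaSqGrad (L + τ • H)) H) τ := by
  have h := (hasGradientAt_areaSq (L + τ • H)).hasFDerivAt.comp_hasDerivAt τ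
    (Sym3.hasDerivAt_line L H τ)
  rwa [InnerProductSpace.toDual_apply_apply] at h

theorem hasDerivAt_inner_areaSqGrad_line (L H : Sym3) (τ : ℝ) :
    HasDerivAt (fun τ : ℝ => inner ℝ (areaSqGrad (L + τ • H)) H)
      (areaSqHess (L + τ • H) H) τ := by
  simp only [inner_areaSqGrad]
  exact (traceMulCLM (cofStrain H)).hasFDerivAt.comp_hasDerivAt τ
    ((Mat3.differentiable_exp (cofStrain (L + τ • H))).hasFDerivAt.comp_hasDerivAt τ
      (cofStrain.hasFDerivAt.comp_hasDerivAt τ (Sym3.hasDerivAt_line L H τ)))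

/-- `areaSq` is convex along lines, since its second derivative is nonnegative. -/
theorem areaSq_line_le_max (L H : Sym3) {τ : ℝ} (hτ : τ ∈ Set.Icc (0 : ℝ) 1) :
    areaSq (L + τ • H) ≤ max (areaSq L) (areaSq (L + H)) := by
  have hconv : ConvexOn ℝ Set.univ fun τ : ℝ => areaSq (L + τ • H) := by
    refine convexOn_of_hasDerivWithinAt2_nonneg convex_univ
      (fun τ _ => (hasDerivAt_areaSq_line L H τ).continuousAt.continuousWithinAt)
      (fun τ _ => (hasDerivAt_areaSq_line L H τ).hasDerivWithinAt)
      (fun τ _ => (hasDerivAt_inner_areaSqGrad_line L H τ).hasDerivWithinAt) fun τ _ => ?_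
    rcases eq_or_ne H 0 with rfl | hH
    · simp [areaSqHess]
    · exact (areaSqHess_pos _ hH).le
  have h := hconv.le_on_segment (Set.mem_univ 0) (Set.mem_univ 1)
    (by rwa [segment_eq_Icc zero_le_one])
  simpa using h

end HenckyStrain

/-! ### Polyconvexity -/

section Polyconvexity

/-- Convexity of the finite part of the energy in `(cof F, det F)`. -/
theorem areaLimited_convex_combo {α β γ c k : ℝ} (hα : 1 ≤ α) (hγ : 0 ≤ γ) {A B : Mat3}
    {d e : ℝ} (hA : ‖A‖ ^ α < β) (hB : ‖B‖ ^ α < β) (hd : 0 < d) (he : 0 < e) {a b : ℝ}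
    (ha : 0 < a) (hb : 0 < b) (hab : a + b = 1) :
    ‖a • A + b • B‖ ^ α < β ∧
    -Real.log (β - ‖a • A + b • B‖ ^ α) - γ * Real.log (a * d + b * e) + c * (a * d + b * e) + k ≤
      a * (-Real.log (β - ‖A‖ ^ α) - γ * Real.log d + c * d + k) +
      b * (-Real.log (β - ‖B‖ ^ α) - γ * Real.log e + c * e + k) := by
  have h1 : ‖a • A + b • B‖ ^ α ≤ a * ‖A‖ ^ α + b * ‖B‖ ^ α := by
    have hn : ‖a • A + b • B‖ ≤ a * ‖A‖ + b * ‖B‖ := by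
      refine (norm_add_le _ _).trans (le_of_eq ?_)
      rw [norm_smul, norm_smul, Real.norm_of_nonneg ha.le, Real.norm_of_nonneg hb.le]
    refine (Real.rpow_le_rpow (norm_nonneg _) hn (by linarith)).trans ?_
    exact (convexOn_rpow hα).2 (norm_nonneg A) (norm_nonneg B) ha.le hb.le hab
  have h2 : a * ‖A‖ ^ α + b * ‖B‖ ^ α < β := by
    have := mul_lt_mul_of_pos_left hA ha
    have := mul_lt_mul_of_pos_left hB hb
    have : a * β + b * β = β := by rw [← add_mul, hab, one_mul]
    linarith
  refine ⟨h1.trans_lt h2, ?_⟩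
  have hlog := strictConcaveOn_log_Ioi.concaveOn
  have h3 : a * Real.log (β - ‖A‖ ^ α) + b * Real.log (β - ‖B‖ ^ α) ≤
      Real.log (β - ‖a • A + b • B‖ ^ α) := by
    have h := hlog.2 (sub_pos.2 hA) (sub_pos.2 hB) ha.le hb.le hab
    simp only [smul_eq_mul] at h
    refine h.trans (Real.log_le_log ?_ ?_)
    · have := mul_pos ha (sub_pos.2 hA)
      have := mul_pos hb (sub_pos.2 hB)
      linarith
    · have : a * β + b * β = β := by rw [← add_mul, hab, one_mul]
      linarith
  have h4 : a * Real.log d + b * Real.log e ≤ Real.log (a * d + b * e) :=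
    hlog.2 hd he ha.le hb.le hab
  have h5 : a * k + b * k = k := by rw [← add_mul, hab, one_mul]
  linarith [mul_le_mul_of_nonneg_left h4 hγ]

theorem polyconvex_areaLimitedEnergy {α β γ : ℝ} (k : ℝ) (hα : 1 ≤ α) (hγ : 0 ≤ γ) :
    Polyconvex (areaLimitedEnergy α β γ k) := by
  classical
  let c := γ - 2 * α * ((3 : ℝ) ^ (α / 2 - 1) / (β - (3 : ℝ) ^ (α / 2)))
  let f : Mat3 × Mat3 × ℝ → ℝ := fun x =>
    -Real.log (β - ‖x.2.1‖ ^ α) - γ * Real.log x.2.2 + c * x.2.2 + k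
  let P : Mat3 × Mat3 × ℝ → EReal := fun x => if ‖x.2.1‖ ^ α < β then (f x : EReal) else ⊤
  have hbot : ∀ x, P x ≠ ⊥ := by
    intro x
    by_cases h : ‖x.2.1‖ ^ α < β <;> simp [P, h]
  have hmul : ∀ (a : ℝ) x, 0 < a → (a : EReal) * P x ≠ ⊥ := by
    intro a x ha
    by_cases h : ‖x.2.1‖ ^ α < β
    · simp only [P, h, if_true]
      rw [← EReal.coe_mul]
      exact EReal.coe_ne_bot _
    · simp [P, h, EReal.coe_mul_top_of_pos ha]
  refine ⟨P, fun x _ => hbot x, ?_, fun F _ => ?_⟩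
  · intro x y hx hy a b ha hb hab
    by_cases h1 : ‖x.2.1‖ ^ α < β
    · by_cases h2 : ‖y.2.1‖ ^ α < β
      · obtain ⟨h3, h4⟩ := areaLimited_convex_combo (c := c) (k := k) hα hγ h1 h2 hx hy ha hb hab
        have h3' : ‖(a • x + b • y).2.1‖ ^ α < β := h3
        simp only [P, h1, h2, h3', if_true]
        rw [← EReal.coe_mul, ← EReal.coe_mul, ← EReal.coe_add, EReal.coe_le_coe_iff]
        exact h4
      · have : (b : EReal) * P y = ⊤ := by simp [P, h2, EReal.coe_mul_top_of_pos hb]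
        rw [this, EReal.add_top_of_ne_bot (hmul a x ha)]
        exact le_top
    · have : (a : EReal) * P x = ⊤ := by simp [P, h1, EReal.coe_mul_top_of_pos ha]
      rw [this, EReal.top_add_of_ne_bot (hmul b y hb)]
      exact le_top
  · simp only [areaLimitedEnergy, P, f, c]

end Polyconvexity

/-! ### The stress response on the restricted domain -/

section StressResponse

open NormedSpace Topology

theorem areaLimitedEnergy_exp_of_lt {α β γ k : ℝ} {L : Sym3} (hL : areaSq L ^ (α / 2) < β) :
    areaLimitedEnergy α β γ k (exp L.toMat) =
      ((-Real.log (β - areaSq L ^ (α / 2)) - γ * traceSym L +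
        (γ - 2 * α * ((3 : ℝ) ^ (α / 2 - 1) / (β - (3 : ℝ) ^ (α / 2)))) * Real.exp (traceSym L)
        + k : ℝ) : EReal) := by
  rw [areaLimitedEnergy, norm_cof_exp_rpow, if_pos hL, Mat3.det_exp L.isSymm_toMat, Real.log_exp,
    traceSym_apply]

theorem mem_henckyDomain_areaLimitedEnergy {α β γ k : ℝ} {L : Sym3} :
    L ∈ henckyDomain (areaLimitedEnergy α β γ k) ↔ areaSq L ^ (α / 2) < β := by
  refine ⟨fun ⟨r, hr⟩ => ?_, fun h => ⟨_, areaLimitedEnergy_exp_of_lt h⟩⟩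
  by_contra h
  rw [areaLimitedEnergy, norm_cof_exp_rpow, if_neg h] at hr
  exact EReal.top_ne_coe r hr

theorem continuous_areaSq : Continuous areaSq :=
  continuous_iff_continuousAt.2 fun L => (hasGradientAt_areaSq L).continuousAt

theorem isOpen_henckyDomain_areaLimitedEnergy {α β γ k : ℝ} :
    IsOpen (henckyDomain (areaLimitedEnergy α β γ k)) := by
  have h : henckyDomain (areaLimitedEnergy α β γ k) = {L | areaSq L ^ (α / 2) < β} :=
    Set.ext fun L => mem_henckyDomain_areaLimitedEnergy
  rw [h]
  exact isOpen_lt (continuous_areaSq.rpow_const fun L => Or.inl (areaSq_pos L).ne') continuous_const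

/-- The derivative of `s ↦ -log (β - s ^ p)`. -/
noncomputable def areaStressCoeff (p β s : ℝ) : ℝ := p * s ^ (p - 1) / (β - s ^ p)

theorem hasDerivAt_neg_log_sub_rpow {p β s : ℝ} (hs : 0 < s) (hβ : s ^ p < β) :
    HasDerivAt (fun s => -Real.log (β - s ^ p)) (areaStressCoeff p β s) s := by
  have h := (((Real.hasDerivAt_rpow_const (p := p) (Or.inl hs.ne')).const_sub β).log
    (sub_pos.2 hβ).ne').neg
  refine h.congr_deriv ?_
  rw [areaStressCoeff, neg_div, neg_neg]

/-- The derivative of `areaStressCoeff p β`, written with `s ^ p` as the only power of `s` with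
a variable exponent. -/
noncomputable def areaStressCoeffDeriv (p β s : ℝ) : ℝ :=
  p * (β * p * s ^ p / (β - s ^ p) ^ 2 - s ^ p / (β - s ^ p)) / s ^ 2

theorem hasDerivAt_areaStressCoeff {p β s : ℝ} (hs : 0 < s) (hβ : s ^ p < β) :
    HasDerivAt (areaStressCoeff p β) (areaStressCoeffDeriv p β s) s := by
  have h0 : β - s ^ p ≠ 0 := (sub_pos.2 hβ).ne'
  have h1 := (Real.hasDerivAt_rpow_const (p := p) (Or.inl hs.ne')).const_sub β
  have h2 := (Real.hasDerivAt_rpow_const (p := p - 1) (Or.inl hs.ne')).const_mul p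
  refine (h2.div h1 h0).congr_deriv ?_
  rw [areaStressCoeffDeriv, Real.rpow_sub_one hs.ne', Real.rpow_sub_one hs.ne']
  field_simp
  ring

/-- The quadratic form `ψ b + ψ' a² - ψ h a + γ h²`, with `ψ` the coefficient `areaStressCoeff`,
is positive. Since `b ≥ a² / s`, it suffices that `(ψ' + ψ / s) a² - ψ h a + γ h²` is; its
discriminant is negative because `ψ' + ψ / s = β ψ² / s ^ p` and `s ^ p < β ≤ 4 γ β`. -/
theorem stress_quadratic_pos {p β γ s : ℝ} (hp : 0 < p) (hγ : 1 / 4 ≤ γ) (hs : 0 < s)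
    (hβ : s ^ p < β) {a b h : ℝ} (hab : a ^ 2 ≤ s * b) (hb : 0 < b) :
    0 < areaStressCoeffDeriv p β s * a ^ 2 + areaStressCoeff p β s * b -
      areaStressCoeff p β s * h * a + γ * h ^ 2 := by
  have hx : 0 < s ^ p := Real.rpow_pos_of_pos hs p
  have hd : 0 < β - s ^ p := sub_pos.2 hβ
  have hψ : areaStressCoeff p β s = p * s ^ p / (s * (β - s ^ p)) := by
    rw [areaStressCoeff, Real.rpow_sub_one hs.ne']
    field_simp
  have hψpos : 0 < areaStressCoeff p β s := by rw [hψ]; positivity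
  have hsum : areaStressCoeffDeriv p β s + areaStressCoeff p β s / s =
      β / s ^ p * areaStressCoeff p β s ^ 2 := by
    rw [hψ, areaStressCoeffDeriv]
    field_simp
    ring
  have hq : 1 < β / s ^ p := (one_lt_div hx).2 hβ
  have hbs : a ^ 2 / s ≤ b := (div_le_iff₀' hs).2 hab
  generalize areaStressCoeff p β s = ψ at *
  generalize areaStressCoeffDeriv p β s = ψ' at *
  generalize β / s ^ p = q at *
  have e1 : ψ' * a ^ 2 = q * ψ ^ 2 * a ^ 2 - ψ * (a ^ 2 / s) := by
    rw [← hsum]; ring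
  -- Complete the square, using `q = β / s ^ p > 1`.
  have e2 : ψ' * a ^ 2 + ψ * b - ψ * h * a + γ * h ^ 2 =
      (q - 1) * (ψ * a) ^ 2 + (ψ * a - h / 2) ^ 2 + (γ - 1 / 4) * h ^ 2
        + ψ * (b - a ^ 2 / s) := by
    rw [e1]; ring
  rw [e2]
  have t2 := sq_nonneg (ψ * a - h / 2)
  have t3 : 0 ≤ (γ - 1 / 4) * h ^ 2 := mul_nonneg (by linarith) (sq_nonneg _)
  have t4 : 0 ≤ ψ * (b - a ^ 2 / s) := mul_nonneg hψpos.le (by linarith)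
  rcases eq_or_ne a 0 with rfl | ha
  · have : 0 < ψ * b := mul_pos hψpos hb
    simp only [ne_eq, OfNat.ofNat_ne_zero, not_false_eq_true, zero_pow, zero_div, sub_zero] at *
    nlinarith
  · have : 0 < (q - 1) * (ψ * a) ^ 2 :=
      mul_pos (by linarith) (by have := mul_ne_zero hψpos.ne' ha; positivity)
    linarith

/-- The gradient of the energy as a function of the Hencky strain; `c` is the coefficient of
`det F`. -/
noncomputable def areaLimitedGrad (p β γ c : ℝ) (L : Sym3) : Sym3 :=
  areaStressCoeff p β (areaSq L) • areaSqGrad L + (-γ + c * Real.exp (traceSym L)) • oneSym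

theorem hasGradientAt_henckyEnergy {α β γ k : ℝ} {L : Sym3} (hL : areaSq L ^ (α / 2) < β) :
    HasGradientAt (henckyEnergy (areaLimitedEnergy α β γ k))
      (areaLimitedGrad (α / 2) β γ
        (γ - 2 * α * ((3 : ℝ) ^ (α / 2 - 1) / (β - (3 : ℝ) ^ (α / 2)))) L) L := by
  set c := γ - 2 * α * ((3 : ℝ) ^ (α / 2 - 1) / (β - (3 : ℝ) ^ (α / 2))) with hc
  have hev : henckyEnergy (areaLimitedEnergy α β γ k) =ᶠ[𝓝 L] fun L =>
      -Real.log (β - areaSq L ^ (α / 2)) - γ * traceSym L + c * Real.exp (traceSym L) + k := by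
    have hopen := isOpen_henckyDomain_areaLimitedEnergy (α := α) (β := β) (γ := γ) (k := k)
    filter_upwards [hopen.mem_nhds (mem_henckyDomain_areaLimitedEnergy.2 hL)] with L' hL'
    rw [henckyEnergy, areaLimitedEnergy_exp_of_lt (mem_henckyDomain_areaLimitedEnergy.1 hL'),
      EReal.toReal_coe]
  rw [hasGradientAt_iff_hasFDerivAt]
  refine HasFDerivAt.congr_of_eventuallyEq ?_ hev
  have h1 := (hasDerivAt_neg_log_sub_rpow (areaSq_pos L) hL).comp_hasFDerivAt L
    (hasGradientAt_areaSq L).hasFDerivAt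
  have h2 := (traceSym.hasFDerivAt (x := L)).const_mul γ
  have h3 := ((traceSym.hasFDerivAt (x := L)).exp).const_mul c
  refine (((h1.sub h2).add h3).add_const k).congr_fderiv ?_
  ext H
  simp [areaLimitedGrad, inner_oneSym]
  ring

end StressResponse

/-! ### Monotonicity of the Cauchy stress -/

section Monotonicity

open NormedSpace Topology

theorem hasStressResponse_areaLimitedEnergy (α β γ k : ℝ) :
    HasStressResponse (areaLimitedEnergy α β γ k) :=
  ⟨isOpen_henckyDomain_areaLimitedEnergy, fun _ hL =>
    (hasGradientAt_henckyEnergy (mem_henckyDomain_areaLimitedEnergy.1 hL)).differentiableAt⟩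

theorem cauchyStress_areaLimitedEnergy {α β γ k : ℝ} {L : Sym3} (hL : areaSq L ^ (α / 2) < β) :
    cauchyStress (areaLimitedEnergy α β γ k) L = (Real.exp (traceSym L))⁻¹ •
      areaLimitedGrad (α / 2) β γ
        (γ - 2 * α * ((3 : ℝ) ^ (α / 2 - 1) / (β - (3 : ℝ) ^ (α / 2)))) L := by
  rw [cauchyStress, Mat3.det_exp L.isSymm_toMat, (hasGradientAt_henckyEnergy hL).gradient,
    traceSym_apply]

theorem differentiableAt_cauchyStress {α β γ k : ℝ} {L : Sym3} (hL : areaSq L ^ (α / 2) < β) :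
    DifferentiableAt ℝ (cauchyStress (areaLimitedEnergy α β γ k)) L := by
  have hev : cauchyStress (areaLimitedEnergy α β γ k) =ᶠ[𝓝 L] fun L =>
      (Real.exp (traceSym L))⁻¹ • areaLimitedGrad (α / 2) β γ
        (γ - 2 * α * ((3 : ℝ) ^ (α / 2 - 1) / (β - (3 : ℝ) ^ (α / 2)))) L := by
    have hopen := isOpen_henckyDomain_areaLimitedEnergy (α := α) (β := β) (γ := γ) (k := k)
    filter_upwards [hopen.mem_nhds (mem_henckyDomain_areaLimitedEnergy.2 hL)] with L' hL'
    exact cauchyStress_areaLimitedEnergy (mem_henckyDomain_areaLimitedEnergy.1 hL')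
  refine DifferentiableAt.congr_of_eventuallyEq ?_ hev
  have htr : DifferentiableAt ℝ (fun L => Real.exp (traceSym L)) L :=
    traceSym.differentiableAt.exp
  have hcoeff : DifferentiableAt ℝ (fun L => areaStressCoeff (α / 2) β (areaSq L)) L :=
    (hasDerivAt_areaStressCoeff (areaSq_pos L) hL).differentiableAt.comp L
      (hasGradientAt_areaSq L).differentiableAt
  exact (htr.inv (Real.exp_pos _).ne').smul
    ((hcoeff.smul (differentiable_areaSqGrad L)).add
      (((htr.const_mul _).const_add _).smul_const oneSym))

/-- The stress, tested against the direction of a line in the restricted domain, has positive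
derivative along that line. -/
theorem exists_pos_hasDerivAt_inner_cauchyStress {α β γ k : ℝ} (hα : 0 < α) (hγ : 1 / 4 ≤ γ)
    {L H : Sym3} (hH : H ≠ 0) {τ : ℝ} (hL : areaSq (L + τ • H) ^ (α / 2) < β) :
    ∃ d, 0 < d ∧ HasDerivAt
      (fun τ : ℝ => inner ℝ (cauchyStress (areaLimitedEnergy α β γ k) (L + τ • H)) H) d τ := by
  set c := γ - 2 * α * ((3 : ℝ) ^ (α / 2 - 1) / (β - (3 : ℝ) ^ (α / 2))) with hc
  have hev : (fun τ : ℝ => inner ℝ (cauchyStress (areaLimitedEnergy α β γ k) (L + τ • H)) H)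
      =ᶠ[𝓝 τ] fun τ => Real.exp (-traceSym (L + τ • H)) *
        (areaStressCoeff (α / 2) β (areaSq (L + τ • H)) * inner ℝ (areaSqGrad (L + τ • H)) H
          - γ * traceSym H) + c * traceSym H := by
    have hopen : IsOpen {L | areaSq L ^ (α / 2) < β} :=
      isOpen_lt (continuous_areaSq.rpow_const fun L => Or.inl (areaSq_pos L).ne')
        continuous_const
    have hmem : ∀ᶠ τ' in 𝓝 τ, L + τ' • H ∈ {L | areaSq L ^ (α / 2) < β} :=
      (Sym3.hasDerivAt_line L H τ).continuousAt.eventually (hopen.mem_nhds hL)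
    filter_upwards [hmem] with τ' hτ'
    rw [cauchyStress_areaLimitedEnergy hτ', ← hc, areaLimitedGrad, inner_smul_left,
      inner_add_left, inner_smul_left, inner_smul_left, inner_oneSym, Real.exp_neg]
    have := (Real.exp_pos (traceSym (L + τ' • H))).ne'
    simp only [conj_trivial]
    field_simp
    ring
  have htr : HasDerivAt (fun τ : ℝ => traceSym (L + τ • H)) (traceSym H) τ :=
    traceSym.hasFDerivAt.comp_hasDerivAt τ (Sym3.hasDerivAt_line L H τ)
  have hψ := (hasDerivAt_areaStressCoeff (areaSq_pos (L + τ • H)) hL).comp τ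
    (hasDerivAt_areaSq_line L H τ)
  have hder := ((htr.neg.exp.mul ((hψ.mul (hasDerivAt_inner_areaSqGrad_line L H τ)).sub_const
    (γ * traceSym H))).add_const (c * traceSym H)).congr_of_eventuallyEq hev
  refine ⟨_, ?_, hder⟩
  have hpos := mul_pos (Real.exp_pos (-traceSym (L + τ • H)))
    (stress_quadratic_pos (h := traceSym H) (half_pos hα) hγ (areaSq_pos (L + τ • H)) hL
      (sq_inner_areaSqGrad_le (L + τ • H) H) (areaSqHess_pos (L + τ • H) hH))
  refine hpos.trans_eq ?_
  simp only [Function.comp_apply, Pi.mul_apply, Pi.neg_apply]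
  ring

theorem tstsMPlusPlus_areaLimitedEnergy {α β γ : ℝ} (k : ℝ) (hα : 0 < α) (hγ : 1 / 4 ≤ γ) :
    TSTSMPlusPlus (areaLimitedEnergy α β γ k) := by
  refine ⟨hasStressResponse_areaLimitedEnergy α β γ k, fun L hL => ?_⟩
  have hL' := mem_henckyDomain_areaLimitedEnergy.1 hL
  have hdiff := differentiableAt_cauchyStress (γ := γ) (k := k) hL'
  refine ⟨hdiff, fun H hH => ?_⟩
  have h0 : L + (0 : ℝ) • H = L := by simp
  obtain ⟨d, hd, hder⟩ := exists_pos_hasDerivAt_inner_cauchyStress (γ := γ) (k := k) hα hγ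
    (L := L) (τ := 0) hH (by rwa [h0])
  have hfd : HasFDerivAt (cauchyStress (areaLimitedEnergy α β γ k))
      (fderiv ℝ (cauchyStress (areaLimitedEnergy α β γ k)) L) (L + (0 : ℝ) • H) := by
    rw [h0]
    exact hdiff.hasFDerivAt
  have hchain := (hfd.comp_hasDerivAt 0 (Sym3.hasDerivAt_line L H 0)).inner ℝ
    (hasDerivAt_const (0 : ℝ) H)
  rw [inner_zero_right, zero_add] at hchain
  rwa [← hder.unique hchain]

/-- The restricted domain is convex, so the derivative along the segment from `L` to `L'` can be
integrated. -/
theorem tstsMPlus_areaLimitedEnergy {α β γ : ℝ} (k : ℝ) (hα : 0 < α) (hγ : 1 / 4 ≤ γ) :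
    TSTSMPlus (areaLimitedEnergy α β γ k) := by
  refine ⟨hasStressResponse_areaLimitedEnergy α β γ k, fun L hL L' hL' hne => ?_⟩
  rw [mem_henckyDomain_areaLimitedEnergy] at hL hL'
  have hseg : ∀ τ ∈ Set.Icc (0 : ℝ) 1, areaSq (L + τ • (L' - L)) ^ (α / 2) < β := by
    intro τ hτ
    have h := areaSq_line_le_max L (L' - L) hτ
    rw [add_sub_cancel] at h
    refine (Real.rpow_le_rpow (areaSq_pos _).le h (half_pos hα).le).trans_lt ?_
    rcases max_choice (areaSq L) (areaSq L') with h' | h' <;> rw [h'] <;> assumption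
  have hH : L' - L ≠ 0 := sub_ne_zero.2 hne.symm
  choose! d hd hder using fun τ hτ => exists_pos_hasDerivAt_inner_cauchyStress
    (γ := γ) (k := k) hα hγ (L := L) hH (hseg τ hτ)
  have hmono := strictMonoOn_of_hasDerivWithinAt_pos (convex_Icc (0 : ℝ) 1)
    (fun τ hτ => (hder τ hτ).continuousAt.continuousWithinAt)
    (fun τ hτ => (hder τ (interior_subset hτ)).hasDerivWithinAt)
    (fun τ hτ => hd τ (interior_subset hτ))
  have h := hmono (Set.left_mem_Icc.2 zero_le_one) (Set.right_mem_Icc.2 zero_le_one) zero_lt_one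
  simp only [zero_smul, add_zero, one_smul, add_sub_cancel] at h
  rw [inner_sub_left]
  exact sub_pos.2 h

end Monotonicity

theorem mainTheorem6 (α β γ k : ℝ) (hα : 1 ≤ α) (hβ : (3 : ℝ) ^ (α / 2) < β)
    (hγ : 1 / 4 ≤ γ) :
    Polyconvex (areaLimitedEnergy α β γ k) ∧
      TSTSMPlusPlus (areaLimitedEnergy α β γ k) ∧
      TSTSMPlus (areaLimitedEnergy α β γ k) :=
  ⟨polyconvex_areaLimitedEnergy k hα (by linarith),
    tstsMPlusPlus_areaLimitedEnergy k (by linarith) hγ,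
    tstsMPlus_areaLimitedEnergy k (by linarith) hγ⟩
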